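/- Write $\|A\|_F$ for the Frobenius norm, $\|A\|_*$ for the nuclear norm (the sum of the singular values) and $\|A\|_\infty=\max_{i,j}|A_{ij}|$ for the entrywise maximum norm of a real matrix $A$. There are an absolute constant $K$ and a constant $C_{\alpha,\beta}$ depending only on $\alpha$ and $\beta$ such that the following holds for all real $\alpha,\beta$, all real $r\ge 0$, all positive integers $d_1,d_2$ and every integer $d\ge 0$. Let $\check X\in\mathbb{R}^{d_1\times d}$ and $M\in\mathbb{R}^{d\times d_2}$ be such that $\check XM$ is approximately rank-$r$, that is, $\|\check XM\|_*\le\|\check XM\|_\infty\sqrt{r d_1d_2}$, and $\|\check XM\|_\infty\le\alpha$. Let $\tilde Y=\check XM+G$, where $G$ is a random $d_1\times d_2$ matrix whose entries are independent, identically distributed random variables of mean zero, and $\|G\|_\infty\le\beta$ almost surely. Let $$\Omega=\{N\in\mathbb{R}^{d\times d_2}:\ \|\check XN\|_*\le\alpha\sqrt{r d_1d_2},\ \|\check XN\|_\infty\le\alpha\}.$$ Then, with probability at least $1-\frac{K}{d_1+d_2}$, every minimizer $\hat M\in\operatorname{argmin}_{Z\in\Omega}\|\tilde Y-\check XZ\|_F$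 satisfies $$\frac{\|\check XM-\check X\hat M\|_F^2}{d_1d_2}\le C_{\alpha,\beta}\sqrt{\frac{r(d_1+d_2)}{d_1d_2}}.$$ -/

import Mathlib

open MeasureTheory ProbabilityTheory

/- On real matrices `‖A‖` denotes the Frobenius norm. -/
open scoped Matrix.Norms.Frobenius

namespace LowRankRecovery

noncomputable section

variable {m n k : Type*} [Fintype m] [Fintype n] [Fintype k]

/-- The entrywise sup norm `‖A‖_∞ = max_{i,j} |A i j|`. -/
def maxNorm (A : Matrix m n ℝ) : ℝ := ⨆ p : m × n, |A p.1 p.2|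

/-- The nuclear norm `‖A‖_*`: the sum of the singular values of `A`. -/
def nuclearNorm [DecidableEq n] (A : Matrix m n ℝ) : ℝ :=
  (Matrix.toEuclideanLin A).singularValues.sum fun _ s => s

/-- `Y` is approximately rank-`r`: `‖Y‖_* ≤ ‖Y‖_∞ √(r d₁ d₂)`. -/
def ApproxRank [DecidableEq n] (r : ℝ) (Y : Matrix m n ℝ) : Prop :=
  nuclearNorm Y ≤ maxNorm Y * √(r * Fintype.card m * Fintype.card n)

/-- The feasible set: all `N` with `‖X N‖_* ≤ α √(r d₁ d₂)` and `‖X N‖_∞ ≤ α`. -/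
def feasibleSet [DecidableEq n] (X : Matrix m k ℝ) (α r : ℝ) : Set (Matrix k n ℝ) :=
  {N | nuclearNorm (X * N) ≤ α * √(r * Fintype.card m * Fintype.card n) ∧ maxNorm (X * N) ≤ α}

/-- `Z` minimizes the Frobenius residual `‖Y - X Z‖_F` over the set `S`. -/
def IsLeastSquaresMinimizer (S : Set (Matrix k n ℝ)) (X : Matrix m k ℝ) (Y : Matrix m n ℝ)
    (Z : Matrix k n ℝ) : Prop :=
  Z ∈ S ∧ ∀ N ∈ S, ‖Y - X * Z‖ ≤ ‖Y - X * N‖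

end

end LowRankRecovery

/-! Since M is feasible with residual G, minimality gives ‖XM - XZ‖² ≤ 2⟨XZ - XM, G⟩. By trace
duality this pairing is at most the sum of the two nuclear norms, each at most α√(r d₁ d₂), times
the operator norm of G (`norm_sub_sq_le_of_noise_le`). That operator norm is of order √(d₁ + d₂)
with high probability: Hoeffding's inequality at each pair of net points, then a union bound over at
most 5 ^ (d₁ + d₂) pairs (`exists_event_opNorm_le`). The good event depends on G alone, so it serves
all minimizers at once. -/

namespace LowRankRecovery

open Module
open scoped RealInnerProductSpace Matrix

/-! ### Nets and operator norms. -/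

section Nets

/-- The ball of radius `2` of an `n`-dimensional normed space has a `1`-net with at most `5 ^ n`
points. -/
theorem exists_net (E : Type*) [NormedAddCommGroup E] [NormedSpace ℝ E] [FiniteDimensional ℝ E] :
    ∃ s : Finset E, (∀ c ∈ s, ‖c‖ ≤ 2) ∧ s.card ≤ 5 ^ finrank ℝ E ∧
      ∀ x : E, ‖x‖ ≤ 2 → ∃ c ∈ s, ‖x - c‖ ≤ 1 := by
  classical
  -- A `1`-separated subset of the ball of largest cardinality is a net, since a point farther than
  -- `1` from it could be added. The packing bound ensures that a largest one exists.
  let P : Set ℕ := {k | ∃ s : Finset E, ((∀ c ∈ s, ‖c‖ ≤ 2) ∧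
    ∀ c ∈ s, ∀ d ∈ s, c ≠ d → 1 ≤ ‖c - d‖) ∧ s.card = k}
  have hne : P.Nonempty := ⟨0, ∅, by simp, rfl⟩
  have hbd : BddAbove P := by
    refine ⟨5 ^ finrank ℝ E, ?_⟩
    rintro _ ⟨s, hs, rfl⟩
    exact Besicovitch.card_le_of_separated s hs.1 hs.2
  obtain ⟨s, hs, hcard⟩ := Nat.sSup_mem hne hbd
  refine ⟨s, hs.1, Besicovitch.card_le_of_separated s hs.1 hs.2, fun x hx => ?_⟩
  by_contra! hfar
  have hxs : x ∉ s := fun h => by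
    have := hfar x h
    simp at this
    linarith
  have hmem : (insert x s).card ∈ P := by
    refine ⟨insert x s, ⟨?_, ?_⟩, rfl⟩
    · intro c hc
      rcases Finset.mem_insert.1 hc with rfl | hc
      exacts [hx, hs.1 c hc]
    · intro c hc d hd hcd
      rcases Finset.mem_insert.1 hc with rfl | hc' <;> rcases Finset.mem_insert.1 hd with rfl | hd'
      · exact absurd rfl hcd
      · exact (hfar d hd').le
      · rw [norm_sub_rev]
        exact (hfar c hc').le
      · exact hs.2 c hc' d hd' hcd
  have := le_csSup hbd hmem
  rw [Finset.card_insert_of_notMem hxs] at this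
  omega

/-- The norm of an operator is bounded by its norms on a `1`-net of the ball of radius `2`. -/
theorem opNorm_le_of_net {E F : Type*} [NormedAddCommGroup E] [NormedSpace ℝ E]
    [NormedAddCommGroup F] [NormedSpace ℝ F] (T : E →L[ℝ] F) {s : Set E}
    (hs : ∀ x : E, ‖x‖ ≤ 2 → ∃ c ∈ s, ‖x - c‖ ≤ 1) {t : ℝ} (ht : 0 ≤ t)
    (h : ∀ c ∈ s, ‖T c‖ ≤ t) : ‖T‖ ≤ t := by
  -- Doubling a unit vector costs an error of at most ‖T‖ against a gain of 2‖T x‖, so the error is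
  -- absorbed.
  have key : ‖T‖ ≤ (t + ‖T‖) / 2 := by
    refine T.opNorm_le_of_unit_norm (by positivity) fun x hx => ?_
    obtain ⟨c, hc, hxc⟩ := hs ((2 : ℝ) • x) (by simp [norm_smul, hx])
    have h1 : T ((2 : ℝ) • x) = T c + T ((2 : ℝ) • x - c) := by simp
    have h2 : 2 * ‖T x‖ ≤ ‖T c‖ + ‖T ((2 : ℝ) • x - c)‖ := by
      have := norm_add_le (T c) (T ((2 : ℝ) • x - c))
      rwa [← h1, map_smul, norm_smul, Real.norm_ofNat] at this
    have h3 : ‖T ((2 : ℝ) • x - c)‖ ≤ ‖T‖ * 1 :=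
      (T.le_opNorm _).trans (mul_le_mul_of_nonneg_left hxc (norm_nonneg _))
    linarith [h c hc]
  linarith

/-- The norm of an operator between Euclidean spaces is bounded by the values of its bilinear form
on `1`-nets of the balls of radius `2`. -/
theorem opNorm_le_of_inner_le_of_net {E F : Type*} [NormedAddCommGroup E] [NormedSpace ℝ E]
    [NormedAddCommGroup F] [InnerProductSpace ℝ F] (T : E →L[ℝ] F) {s : Set E} {s' : Set F}
    (hs : ∀ x : E, ‖x‖ ≤ 2 → ∃ c ∈ s, ‖x - c‖ ≤ 1)
    (hs' : ∀ x : F, ‖x‖ ≤ 2 → ∃ c ∈ s', ‖x - c‖ ≤ 1) {t : ℝ} (ht : 0 ≤ t)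
    (h : ∀ x ∈ s', ∀ y ∈ s, ⟪x, T y⟫ ≤ t) : ‖T‖ ≤ t := by
  refine opNorm_le_of_net T hs ht fun y hy => ?_
  set v := T y
  rcases eq_or_ne v 0 with hv | hv
  · simpa [hv] using ht
  have hv' : ‖v‖ ≠ 0 := norm_ne_zero_iff.2 hv
  obtain ⟨c, hc, hxc⟩ := hs' ((2 / ‖v‖) • v) (by
    rw [norm_smul, Real.norm_of_nonneg (by positivity), div_mul_cancel₀ _ hv'])
  have h1 : ⟪(2 / ‖v‖) • v, v⟫ = 2 * ‖v‖ := by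
    rw [real_inner_smul_left, real_inner_self_eq_norm_sq]
    field_simp
  have h2 : ⟪(2 / ‖v‖) • v - c, v⟫ ≤ 1 * ‖v‖ :=
    (real_inner_le_norm _ _).trans (mul_le_mul_of_nonneg_right hxc (norm_nonneg _))
  rw [inner_sub_left, h1] at h2
  linarith [h c hc y hy]

end Nets

/-! ### Nuclear norm and trace duality. -/

section Duality

variable {m n : Type*} [Fintype m] [Fintype n] [DecidableEq n]

/-- The bilinear form of a matrix on Euclidean vectors, in coordinates. -/
theorem inner_toEuclideanLin (A : Matrix m n ℝ) (x : EuclideanSpace ℝ m)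
    (y : EuclideanSpace ℝ n) :
    ⟪x, Matrix.toEuclideanLin A y⟫ = ∑ p : m × n, x p.1 * y p.2 * A p.1 p.2 := by
  simp only [PiLp.inner_apply, Matrix.toLpLin_apply, Matrix.mulVec, dotProduct,
    Fintype.sum_prod_type, RCLike.inner_apply, conj_trivial, Finset.sum_mul]
  exact Finset.sum_congr rfl fun i _ => Finset.sum_congr rfl fun j _ => by ring

theorem nuclearNorm_eq_sum (A : Matrix m n ℝ) {N : ℕ}
    (hN : finrank ℝ (EuclideanSpace ℝ n) = N) :
    nuclearNorm A = ∑ i : Fin N, (Matrix.toEuclideanLin A).singularValues i := by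
  rw [nuclearNorm, Fin.sum_univ_eq_sum_range (Matrix.toEuclideanLin A).singularValues N]
  refine Finsupp.sum_of_support_subset _ (fun i hi => ?_) _ (by simp)
  rw [Finset.mem_range]
  by_contra! hle
  exact Finsupp.mem_support_iff.1 hi
    (LinearMap.singularValues_of_finrank_le _ (hN.trans_le hle))

/-- Trace duality between the nuclear norm and the operator norm. -/
theorem abs_sum_mul_le_nuclearNorm_mul (A B : Matrix m n ℝ) {t : ℝ}
    (hB : ∀ y, ‖Matrix.toEuclideanLin B y‖ ≤ t * ‖y‖) :
    |∑ p : m × n, A p.1 p.2 * B p.1 p.2| ≤ nuclearNorm A * t := by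
  classical
  set T := Matrix.toEuclideanLin A with hT
  set S := Matrix.toEuclideanLin B with hS
  obtain ⟨N, hN⟩ : ∃ N, finrank ℝ (EuclideanSpace ℝ n) = N := ⟨_, rfl⟩
  -- The right singular vectors of A: here ‖T bᵢ‖ is the i-th singular value, and the pairing, being
  -- the trace of T*S, may be computed in this basis.
  set b := T.isSymmetric_adjoint_comp_self.eigenvectorBasis hN with hb
  have htrace : ∑ p : m × n, A p.1 p.2 * B p.1 p.2 = ∑ i, ⟪T (b i), S (b i)⟫ := by
    have h1 := LinearMap.trace_eq_sum_inner (LinearMap.adjoint T ∘ₗ S) b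
    have h2 := LinearMap.trace_eq_sum_inner (LinearMap.adjoint T ∘ₗ S)
      (EuclideanSpace.basisFun n ℝ)
    simp only [LinearMap.comp_apply, LinearMap.adjoint_inner_right] at h1 h2
    rw [← h1, h2, Fintype.sum_prod_type, Finset.sum_comm]
    refine Finset.sum_congr rfl fun j _ => ?_
    simp [PiLp.inner_apply, T, S, Matrix.toLpLin_apply, mul_comm]
  have hnorm : ∀ i, ‖T (b i)‖ = T.singularValues i := fun i => by
    rw [← sq_eq_sq₀ (norm_nonneg _) (T.singularValues_nonneg _), T.sq_singularValues_fin hN,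
      ← real_inner_self_eq_norm_sq, ← LinearMap.adjoint_inner_right, ← LinearMap.comp_apply, hb,
      LinearMap.IsSymmetric.apply_eigenvectorBasis, real_inner_smul_right,
      real_inner_self_eq_norm_sq, OrthonormalBasis.norm_eq_one]
    simp
  rw [htrace, nuclearNorm_eq_sum A hN, Finset.sum_mul]
  refine (Finset.abs_sum_le_sum_abs _ _).trans (Finset.sum_le_sum fun i _ => ?_)
  refine (abs_real_inner_le_norm _ _).trans ?_
  rw [hnorm]
  refine mul_le_mul_of_nonneg_left ?_ (T.singularValues_nonneg _)
  simpa using hB (b i)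

end Duality

/-! ### Deterministic least-squares bound. -/

section Frobenius

variable {m n k : Type*} [Fintype m] [Fintype n] [Fintype k]

theorem frobenius_norm_sq (A : Matrix m n ℝ) : ‖A‖ ^ 2 = ∑ p : m × n, A p.1 p.2 ^ 2 := by
  rw [Matrix.frobenius_norm_def, ← Real.sqrt_eq_rpow, Real.sq_sqrt (by positivity),
    Fintype.sum_prod_type]
  simp

theorem abs_apply_le_maxNorm (A : Matrix m n ℝ) (i : m) (j : n) : |A i j| ≤ maxNorm A :=
  le_ciSup (f := fun p : m × n => |A p.1 p.2|) (Set.finite_range _).bddAbove (i, j)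

omit [Fintype m] [Fintype n] in
theorem maxNorm_nonneg (A : Matrix m n ℝ) : 0 ≤ maxNorm A :=
  Real.iSup_nonneg fun _ => abs_nonneg _

/-- The basic inequality of constrained least squares. -/
theorem norm_sub_sq_le {S : Set (Matrix k n ℝ)} {X : Matrix m k ℝ} {M Z : Matrix k n ℝ}
    {G : Matrix m n ℝ} (hM : M ∈ S) (hZ : IsLeastSquaresMinimizer S X (X * M + G) Z) :
    ‖X * M - X * Z‖ ^ 2 ≤ 2 * (∑ p : m × n, (X * Z) p.1 p.2 * G p.1 p.2 -
      ∑ p : m × n, (X * M) p.1 p.2 * G p.1 p.2) := by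
  have h := pow_le_pow_left₀ (norm_nonneg _) (hZ.2 M hM) 2
  rw [add_sub_cancel_left, frobenius_norm_sq, frobenius_norm_sq] at h
  rw [frobenius_norm_sq]
  have : ∑ p : m × n, (X * M + G - X * Z) p.1 p.2 ^ 2 =
      ∑ p : m × n, (X * M - X * Z) p.1 p.2 ^ 2 + ∑ p : m × n, G p.1 p.2 ^ 2 -
      2 * (∑ p : m × n, (X * Z) p.1 p.2 * G p.1 p.2 -
        ∑ p : m × n, (X * M) p.1 p.2 * G p.1 p.2) := by
    rw [← Finset.sum_sub_distrib, Finset.mul_sum, ← Finset.sum_add_distrib,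
      ← Finset.sum_sub_distrib]
    refine Finset.sum_congr rfl fun p _ => ?_
    simp only [Matrix.sub_apply, Matrix.add_apply]
    ring
  linarith

/-- On the feasible set the residual is controlled by the operator norm of the noise. -/
theorem norm_sub_sq_le_of_noise_le [DecidableEq n] {X : Matrix m k ℝ} {M Z : Matrix k n ℝ}
    {G : Matrix m n ℝ} {α r t : ℝ} (ht : 0 ≤ t) (hM : M ∈ feasibleSet X α r)
    (hZ : IsLeastSquaresMinimizer (feasibleSet X α r) X (X * M + G) Z)
    (hG : ∀ y, ‖Matrix.toEuclideanLin G y‖ ≤ t * ‖y‖) :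
    ‖X * M - X * Z‖ ^ 2 ≤ 4 * α * √(r * Fintype.card m * Fintype.card n) * t := by
  have h1 := (abs_le.1 (abs_sum_mul_le_nuclearNorm_mul (X * Z) G hG)).2
  have h2 := (abs_le.1 (abs_sum_mul_le_nuclearNorm_mul (X * M) G hG)).1
  have h3 := mul_le_mul_of_nonneg_right hZ.1.1 ht
  have h4 := mul_le_mul_of_nonneg_right hM.1 ht
  linarith [norm_sub_sq_le hM hZ]

end Frobenius

/-! ### Concentration of the noise. -/

section Noise

variable {Ω : Type*} [MeasurableSpace Ω] {μ : Measure Ω} [IsProbabilityMeasure μ]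
  {m n : Type*} [Fintype m] [Fintype n]

/-- Hoeffding's inequality for a weighted sum of independent centered variables bounded by `B`. -/
theorem measure_weighted_sum_ge_le {ι : Type*} [Fintype ι] {g : ι → Ω → ℝ} {B : ℝ}
    (hmeas : ∀ i, Measurable (g i)) (hindep : iIndepFun g μ) (hmean : ∀ i, ∫ ω, g i ω ∂μ = 0)
    (hbd : ∀ i, ∀ᵐ ω ∂μ, |g i ω| ≤ B) (hB : 0 < B) (w : ι → ℝ) {v : ℝ}
    (hw : ∑ i, w i ^ 2 ≤ v) {t : ℝ} (ht : 0 ≤ t) :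
    μ.real {ω | t ≤ ∑ i, w i * g i ω} ≤ Real.exp (-t ^ 2 / (2 * (v * B ^ 2))) := by
  have hsub : ∀ i, HasSubgaussianMGF (fun ω => w i * g i ω) (w i ^ 2 * B ^ 2).toNNReal μ := by
    intro i
    convert (hasSubgaussianMGF_of_mem_Icc_of_integral_eq_zero (hmeas i).aemeasurable
      ((hbd i).mono fun ω h => abs_le.1 h) (hmean i)).const_mul (w i) using 1
    have : ‖B - -B‖ / 2 = B := by
      rw [Real.norm_of_nonneg (by linarith)]
      ring
    apply NNReal.eq
    rw [Real.coe_toNNReal _ (by positivity)]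
    change w i ^ 2 * B ^ 2 = w i ^ 2 * (‖B - -B‖ / 2) ^ 2
    rw [this]
  have hind : iIndepFun (fun i ω => w i * g i ω) μ :=
    hindep.comp (fun i x => w i * x) fun i => measurable_const_mul (w i)
  -- For zero weights the sub-Gaussian bound divides by zero and reads exp 0 = 1, too weak when v >
  -- 0.
  rcases eq_or_ne (∑ i, w i ^ 2) 0 with h0 | h0
  · have hz : ∀ i, w i = 0 := fun i => by
      simpa using (Finset.sum_eq_zero_iff_of_nonneg fun i _ => sq_nonneg (w i)).1 h0 i
        (Finset.mem_univ i)
    rcases ht.eq_or_lt with rfl | ht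
    · simp
    · simp only [hz, zero_mul, Finset.sum_const_zero, not_le.2 ht, Set.ofPred_false,
        measureReal_empty]
      positivity
  refine (HasSubgaussianMGF.measure_sum_ge_le_of_iIndepFun hind
    (fun i _ => hsub i) ht).trans (Real.exp_le_exp.2 ?_)
  have hpos : 0 < ∑ i, w i ^ 2 := (Finset.sum_nonneg fun i _ => sq_nonneg _).lt_of_ne' h0
  have hsum : ((∑ i, (w i ^ 2 * B ^ 2).toNNReal : NNReal) : ℝ) = (∑ i, w i ^ 2) * B ^ 2 := by
    rw [NNReal.coe_sum, Finset.sum_mul]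
    exact Finset.sum_congr rfl fun i _ => Real.coe_toNNReal _ (by positivity)
  rw [hsum, neg_div, neg_div, neg_le_neg_iff]
  gcongr

/-- The tail of the bilinear form of the noise at a fixed pair of vectors of norm at most `2`. -/
theorem measure_bilinear_ge_le {G : Ω → Matrix m n ℝ} {B : ℝ} (hB : 0 < B)
    (hmeas : ∀ i j, Measurable fun ω => G ω i j)
    (hindep : iIndepFun (fun (p : m × n) (ω : Ω) => G ω p.1 p.2) μ)
    (hmean : ∀ i j, ∫ ω, G ω i j ∂μ = 0) (hbd : ∀ i j, ∀ᵐ ω ∂μ, |G ω i j| ≤ B)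
    {x : EuclideanSpace ℝ m} {y : EuclideanSpace ℝ n} (hx : ‖x‖ ≤ 2) (hy : ‖y‖ ≤ 2)
    {t : ℝ} (ht : 0 ≤ t) :
    μ.real {ω | t ≤ ∑ p : m × n, x p.1 * y p.2 * G ω p.1 p.2} ≤
      Real.exp (-t ^ 2 / (32 * B ^ 2)) := by
  have hw : ∑ p : m × n, (x p.1 * y p.2) ^ 2 ≤ 16 := by
    have : ∑ p : m × n, (x p.1 * y p.2) ^ 2 = ‖x‖ ^ 2 * ‖y‖ ^ 2 := by
      simp only [EuclideanSpace.real_norm_sq_eq, Finset.sum_mul_sum, Fintype.sum_prod_type,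
        mul_pow]
    rw [this]
    have h1 := pow_le_pow_left₀ (norm_nonneg x) hx 2
    have h2 := pow_le_pow_left₀ (norm_nonneg y) hy 2
    calc ‖x‖ ^ 2 * ‖y‖ ^ 2 ≤ 2 ^ 2 * 2 ^ 2 := by gcongr
      _ = 16 := by norm_num
  have h := measure_weighted_sum_ge_le (g := fun (p : m × n) ω => G ω p.1 p.2)
    (fun p => hmeas p.1 p.2) hindep (fun p => hmean p.1 p.2) (fun p => hbd p.1 p.2) hB
    (fun p => x p.1 * y p.2) hw ht
  convert h using 3
  ring

/-- The union bound: since 5 ≤ e², a tail e^(-3N) beats the number of net pairs and leaves e^(-N).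
-/
theorem five_pow_mul_exp_le {N : ℕ} (hN : 0 < N) :
    (5 : ℝ) ^ N * Real.exp (-(3 * N)) ≤ 1 / N := by
  have h5 : (5 : ℝ) ≤ Real.exp 2 := by
    have : Real.exp 2 = Real.exp 1 * Real.exp 1 := by rw [← Real.exp_add]; norm_num
    nlinarith [Real.exp_one_gt_d9]
  have hN' : (0 : ℝ) < N := Nat.cast_pos.2 hN
  calc (5 : ℝ) ^ N * Real.exp (-(3 * N)) ≤ Real.exp 2 ^ N * Real.exp (-(3 * N)) := by gcongr
    _ = 1 / Real.exp N := by
      rw [← Real.exp_nat_mul, ← Real.exp_add, one_div, ← Real.exp_neg]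
      congr 1
      ring
    _ ≤ 1 / N := one_div_le_one_div_of_le hN' (by linarith [Real.add_one_le_exp (N : ℝ)])

/-- The operator norm of a random matrix with independent centered entries bounded by `B` is of
order `B √(d₁ + d₂)` with high probability. -/
theorem exists_event_opNorm_le [DecidableEq n] [Nonempty m] {G : Ω → Matrix m n ℝ} {B : ℝ}
    (hB : 0 < B) (hmeas : ∀ i j, Measurable fun ω => G ω i j)
    (hindep : iIndepFun (fun (p : m × n) (ω : Ω) => G ω p.1 p.2) μ)
    (hmean : ∀ i j, ∫ ω, G ω i j ∂μ = 0) (hbd : ∀ i j, ∀ᵐ ω ∂μ, |G ω i j| ≤ B) :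
    ∃ A : Set Ω, MeasurableSet A ∧
      1 - 1 / ((Fintype.card m : ℝ) + Fintype.card n) ≤ μ.real A ∧
      ∀ ω ∈ A, ∀ y, ‖Matrix.toEuclideanLin (G ω) y‖ ≤
        10 * B * √((Fintype.card m : ℝ) + Fintype.card n) * ‖y‖ := by
  obtain ⟨s, hs2, hscard, hsnet⟩ := exists_net (EuclideanSpace ℝ m)
  obtain ⟨s', hs2', hscard', hsnet'⟩ := exists_net (EuclideanSpace ℝ n)
  rw [finrank_euclideanSpace] at hscard hscard'
  -- The factor 10 makes t² / (32 B²) = (100 / 32)(d₁ + d₂), which exceeds 3(d₁ + d₂).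
  set t := 10 * B * √((Fintype.card m : ℝ) + Fintype.card n) with ht_def
  have ht : 0 ≤ t := by positivity
  let bad : EuclideanSpace ℝ m × EuclideanSpace ℝ n → Set Ω := fun q =>
    {ω | t ≤ ∑ p : m × n, q.1 p.1 * q.2 p.2 * G ω p.1 p.2}
  have hbad : ∀ q, MeasurableSet (bad q) := fun q =>
    measurableSet_le measurable_const
      (Finset.measurable_sum _ fun p _ => (hmeas p.1 p.2).const_mul _)
  have hU : MeasurableSet (⋃ q ∈ s ×ˢ s', bad q) := Finset.measurableSet_biUnion _ fun q _ => hbad q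
  refine ⟨(⋃ q ∈ s ×ˢ s', bad q)ᶜ, hU.compl, ?_, fun ω hω => ?_⟩
  · rw [probReal_compl_eq_one_sub hU]
    have hN : 0 < Fintype.card m + Fintype.card n := by
      have := Fintype.card_pos (α := m)
      omega
    have hexp : -t ^ 2 / (32 * B ^ 2) ≤ -(3 * ((Fintype.card m + Fintype.card n : ℕ) : ℝ)) := by
      rw [ht_def, mul_pow, Real.sq_sqrt (by positivity), neg_div, neg_le_neg_iff,
        le_div_iff₀ (by positivity)]
      push_cast
      have : 0 ≤ B ^ 2 * ((Fintype.card m : ℝ) + Fintype.card n) := by positivity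
      linarith
    have hunion : μ.real (⋃ q ∈ s ×ˢ s', bad q) ≤
        1 / ((Fintype.card m + Fintype.card n : ℕ) : ℝ) := by
      calc μ.real (⋃ q ∈ s ×ˢ s', bad q)
          ≤ ∑ q ∈ s ×ˢ s', μ.real (bad q) := measureReal_biUnion_finset_le _ _
        _ ≤ ∑ q ∈ s ×ˢ s', Real.exp (-(3 * ((Fintype.card m + Fintype.card n : ℕ) : ℝ))) := by
            refine Finset.sum_le_sum fun q hq => ?_
            rw [Finset.mem_product] at hq
            exact (measure_bilinear_ge_le hB hmeas hindep hmean hbd (hs2 _ hq.1) (hs2' _ hq.2)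
              ht).trans (Real.exp_le_exp.2 hexp)
        _ ≤ 5 ^ (Fintype.card m + Fintype.card n) *
              Real.exp (-(3 * ((Fintype.card m + Fintype.card n : ℕ) : ℝ))) := by
            rw [Finset.sum_const, nsmul_eq_mul, Finset.card_product, pow_add]
            have := Nat.mul_le_mul hscard hscard'
            refine mul_le_mul_of_nonneg_right ?_ (Real.exp_pos _).le
            exact_mod_cast this
        _ ≤ _ := five_pow_mul_exp_le hN
    push_cast at hunion
    linarith
  · have hop : ‖(Matrix.toEuclideanLin (G ω)).toContinuousLinearMap‖ ≤ t := by
      refine opNorm_le_of_inner_le_of_net _ (s := (s' : Set _)) (s' := (s : Set _)) hsnet' hsnet ht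
        fun x hx y hy => ?_
      rw [LinearMap.coe_toContinuousLinearMap', inner_toEuclideanLin]
      by_contra! hlt
      refine hω (Set.mem_biUnion (x := (x, y)) ?_ hlt.le)
      exact Finset.mem_coe.2 (Finset.mem_product.2 ⟨hx, hy⟩)
    intro y
    exact ((Matrix.toEuclideanLin (G ω)).toContinuousLinearMap.le_opNorm y).trans
      (mul_le_mul_of_nonneg_right hop (norm_nonneg y))

end Noise

end LowRankRecovery

/-! ### The recovery bound. -/

theorem theorem4 :
    ∃ (K : ℝ) (C : ℝ → ℝ → ℝ), ∀ (α β r : ℝ), 0 ≤ r →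
      ∀ (d₁ d₂ d : ℕ), 0 < d₁ → 0 < d₂ →
      ∀ (X : Matrix (Fin d₁) (Fin d) ℝ) (M : Matrix (Fin d) (Fin d₂) ℝ),
        LowRankRecovery.ApproxRank r (X * M) →
        LowRankRecovery.maxNorm (X * M) ≤ α →
      ∀ (Ω : Type*) [MeasurableSpace Ω] (μ : Measure Ω) [IsProbabilityMeasure μ]
        (G : Ω → Matrix (Fin d₁) (Fin d₂) ℝ),
        (∀ i j, Measurable fun ω => G ω i j) →
        iIndepFun (fun (p : Fin d₁ × Fin d₂) (ω : Ω) => G ω p.1 p.2) μ →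
        (∀ p q : Fin d₁ × Fin d₂,
          IdentDistrib (fun ω => G ω p.1 p.2) (fun ω => G ω q.1 q.2) μ μ) →
        (∀ i j, ∫ ω, G ω i j ∂μ = 0) →
        (∀ᵐ ω ∂μ, LowRankRecovery.maxNorm (G ω) ≤ β) →
      ∃ A : Set Ω, MeasurableSet A ∧
        1 - K / ((d₁ : ℝ) + d₂) ≤ μ.real A ∧
        ∀ ω ∈ A, ∀ Mhat : Matrix (Fin d) (Fin d₂) ℝ,
          LowRankRecovery.IsLeastSquaresMinimizer (LowRankRecovery.feasibleSet X α r) X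
            (X * M + G ω) Mhat →
          ‖X * M - X * Mhat‖ ^ 2 / ((d₁ : ℝ) * d₂) ≤
            C α β * √(r * ((d₁ : ℝ) + d₂) / ((d₁ : ℝ) * d₂)) := by
  -- 40 is the 4 of the deterministic bound times the 10 of the noise bound; |β| + 1 is an entry
  -- bound that is positive even when β = 0.
  refine ⟨1, fun α β => 40 * α * (|β| + 1), ?_⟩
  intro α β r hr d₁ d₂ d hd₁ hd₂ X M hrank hα Ω _ μ _ G hmeas hindep _ hmean hbd
  have : Nonempty (Fin d₁) := ⟨⟨0, hd₁⟩⟩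
  have hB : 0 < |β| + 1 := by positivity
  have hα0 : 0 ≤ α := (LowRankRecovery.maxNorm_nonneg _).trans hα
  obtain ⟨A, hA, hprob, hop⟩ := LowRankRecovery.exists_event_opNorm_le hB hmeas hindep hmean
    fun i j => hbd.mono fun ω h => (LowRankRecovery.abs_apply_le_maxNorm (G ω) i j).trans
      (by linarith [le_abs_self β])
  simp only [Fintype.card_fin] at hprob hop
  refine ⟨A, hA, hprob, fun ω hω Z hZ => ?_⟩
  have hM : M ∈ LowRankRecovery.feasibleSet X α r :=
    ⟨hrank.trans (mul_le_mul_of_nonneg_right hα (Real.sqrt_nonneg _)), hα⟩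
  have h := LowRankRecovery.norm_sub_sq_le_of_noise_le (by positivity) hM hZ (hop ω hω)
  simp only [Fintype.card_fin] at h
  have h₁ : (0 : ℝ) < d₁ := Nat.cast_pos.2 hd₁
  have h₂ : (0 : ℝ) < d₂ := Nat.cast_pos.2 hd₂
  rw [div_le_iff₀ (by positivity)]
  refine h.trans_eq ?_
  have hsqrt : √(r * d₁ * d₂) * √((d₁ : ℝ) + d₂) =
      √(r * ((d₁ : ℝ) + d₂) / ((d₁ : ℝ) * d₂)) * ((d₁ : ℝ) * d₂) := by
    rw [← Real.sqrt_mul (by positivity), ← Real.sqrt_sq (by positivity : 0 ≤ (d₁ : ℝ) * d₂),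
      ← Real.sqrt_mul (by positivity), Real.sqrt_sq (by positivity)]
    congr 1
    field_simp
  linear_combination 40 * α * (|β| + 1) * hsqrt
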